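/- Let $d\ge 2$ be an integer. For $u\in C_0^\infty(\mathbb{R}^d)$ (real-valued, smooth, compactly supported) let $Du=(\partial_i u)_{i}$ and $D^2u=(\partial_i\partial_j u)_{i,j}$, with $|Du|$ and $|D^2u|$ their Euclidean norms. For $q>0$ and $\beta\ge 0$ let $\dot E_{q,\beta}$ be the class of measurable functions $f$ on $\mathbb{R}^d$ with $$\sup_{\rho>0}\ \rho^{\beta}\sup_{x\in\mathbb{R}^d}\Big(\frac{1}{|B_\rho(x)|}\int_{B_\rho(x)}|f(y)|^q\,dy\Big)^{1/q}<\infty ,\qquad B_\rho(x)=\{y:|y-x|<\rho\}.$$ (i) (Hardy's inequality.) For every $p\in(1,d)$ there is a finite constant $N=N(d,p)$ such that for all $u\in C_0^\infty(\mathbb{R}^d)$ $$\int_{\mathbb{R}^d}\frac{|u|^p}{|x|^p}\,dx\le N\,\|Du\|_{L_p(\mathbb{R}^d)}^p .$$ (ii) (Second-order Hardy inequality.) For every $r\in(1,d/2)$ there is a finite constant $N=N(d,r)$ such that for all $u\in C_0^\infty(\mathbb{R}^d)$ $$\int_{\mathbb{R}^d}\frac{|u|^r}{|x|^{2r}}\,dx\le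 N\,\|D^2u\|_{L_r(\mathbb{R}^d)}^r .$$ (iii) For every $q\in(1,d)$, the function $|x|^{-1}$ belongs to $\dot E_{q,1}$ and the function $|x|^{-2}$ belongs to $\dot E_{q/2,2}$. -/

import Mathlib

open MeasureTheory
open scoped ENNReal NNReal ContDiff

noncomputable section

/-- The Euclidean space of dimension `d`. -/
abbrev RSpace (d : ℕ) : Type := EuclideanSpace ℝ (Fin d)

/-- The partial derivative of `u` in the `i`-th coordinate direction. -/
def partialD {d : ℕ} (i : Fin d) (u : RSpace d → ℝ) (x : RSpace d) : ℝ :=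
  fderiv ℝ u x (EuclideanSpace.single i 1)

/-- The vector of first partial derivatives, with its Euclidean norm. -/
def gradD {d : ℕ} (u : RSpace d → ℝ) (x : RSpace d) : EuclideanSpace ℝ (Fin d) :=
  WithLp.toLp 2 (fun i => partialD i u x)

/-- The array of second partial derivatives, with its Euclidean (Hilbert-Schmidt) norm. -/
def hessD {d : ℕ} (u : RSpace d → ℝ) (x : RSpace d) : EuclideanSpace ℝ (Fin d × Fin d) :=
  WithLp.toLp 2 (fun ij => partialD ij.1 (partialD ij.2 u) x)

/-- The homogeneous Morrey norm: the supremum over all `ρ > 0` and all open balls `B` of radius `ρ`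
of `ρ ^ β * (average over B of |f| ^ q) ^ (1 / q)`. -/
def morreyNorm {d : ℕ} (q β : ℝ) (f : RSpace d → ℝ) : ℝ≥0∞ :=
  ⨆ (ρ : ℝ) (_ : 0 < ρ), ENNReal.ofReal (ρ ^ β) *
    ⨆ x : RSpace d, (⨍⁻ y in Metric.ball x ρ, ‖f y‖ₑ ^ q ∂volume) ^ (1 / q)

/-- Membership in the homogeneous Morrey space with exponents `q` and `β`. -/
def MemMorrey {d : ℕ} (q β : ℝ) (f : RSpace d → ℝ) : Prop :=
  AEStronglyMeasurable f volume ∧ morreyNorm q β f < ⊤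

end

open MeasureTheory Metric Filter Topology

open scoped ENNReal NNReal ContDiff

/-! Both Hardy inequalities follow from one weighted estimate, `integral_abs_rpow_mul_weight_le`.
Write `w = (ε + |x|²) ^ (-a/2)` with `0 ≤ a < d`. Then `div (w x) ≥ (d - a) w`, so integrating by
parts against `|u|^p` and absorbing with Young's inequality bounds `∫ |u|^p w` by `∫ |Du|^p (ε +
|x|²) ^ ((p-a)/2)`, uniformly in `ε`. The regularisation keeps every integrand continuous with
compact support; Fatou's lemma (`lintegral_enorm_rpow_div_le`) removes it.

Taking `a = p` gives (i). For (ii), `a = 2r` leaves the weight of exponent `-r/2` on `|Du|^r`, which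
is the left side of the case `a = r` for each partial derivative.

For (iii), `|y|^(-q)` is integrable near the origin because `q < d`; scaling gives the bound on
balls centred at `0`, and `setLAverage_inv_rpow_le` extends it to all centres. -/

/-! ### Integration by parts against the radial field -/

theorem fderiv_eq_inner_gradD {d : ℕ} (u : RSpace d → ℝ) (x v : RSpace d) :
    fderiv ℝ u x v = inner ℝ v (gradD u x) := by
  conv_lhs => rw [← (EuclideanSpace.basisFun (Fin d) ℝ).sum_repr v]
  simp [map_sum, gradD, partialD, PiLp.inner_apply, mul_comm]

theorem sum_coord_mul_fderiv {d : ℕ} (u : RSpace d → ℝ) (x v : RSpace d) :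
    ∑ i, v i * fderiv ℝ u x (EuclideanSpace.single i 1) = fderiv ℝ u x v := by
  rw [fderiv_eq_inner_gradD]
  simp [gradD, partialD, PiLp.inner_apply, mul_comm]

/-- Divergence theorem for the field `f w x`, done coordinatewise, with `div (w x) = d w + x · Dw`.
-/
theorem integral_fderiv_self_mul {d : ℕ} {f w : RSpace d → ℝ} (hf : ContDiff ℝ 1 f)
    (hc : HasCompactSupport f) (hw : ContDiff ℝ 1 w) :
    ∫ x, fderiv ℝ f x x * w x = -∫ x, f x * (d * w x + fderiv ℝ w x x) := by
  have hcoord : ∀ i : Fin d, ContDiff ℝ 1 (fun x : RSpace d => x i) := fun i => by fun_prop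
  have hcf : Continuous (fderiv ℝ f) := hf.continuous_fderiv one_ne_zero
  have hcw : Continuous (fderiv ℝ w) := hw.continuous_fderiv one_ne_zero
  have hf0 := hf.continuous
  have hw0 := hw.continuous
  have hg : ∀ i : Fin d, ContDiff ℝ 1 (fun x : RSpace d => x i * w x) :=
    fun i => (hcoord i).mul hw
  have hder : ∀ (i : Fin d) (x : RSpace d),
      fderiv ℝ (fun y : RSpace d => y i * w y) x (EuclideanSpace.single i 1) =
        w x + x i * fderiv ℝ w x (EuclideanSpace.single i 1) := by
    intro i x
    have h1 : HasFDerivAt (fun y : RSpace d => y i) (EuclideanSpace.proj (𝕜 := ℝ) i) x :=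
      (EuclideanSpace.proj (𝕜 := ℝ) i).hasFDerivAt
    have h2 := h1.mul (hw.differentiable one_ne_zero x).hasFDerivAt
    change fderiv ℝ ((fun y : RSpace d => y i) * w) x (EuclideanSpace.single i 1) = _
    rw [h2.fderiv]
    simp
    ring
  have hint1 : ∀ i : Fin d, Integrable fun x : RSpace d =>
      fderiv ℝ f x (EuclideanSpace.single i 1) * (x i * w x) := fun i => by
    refine Continuous.integrable_of_hasCompactSupport (by fun_prop) ?_
    exact HasCompactSupport.mul_right (hc.fderiv_apply ℝ _)
  have hint2 : ∀ i : Fin d, Integrable fun x : RSpace d =>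
      f x * fderiv ℝ (fun y : RSpace d => y i * w y) x (EuclideanSpace.single i 1) := fun i => by
    simp_rw [hder]
    exact Continuous.integrable_of_hasCompactSupport (by fun_prop) hc.mul_right
  have hibp : ∀ i : Fin d,
      ∫ x, fderiv ℝ f x (EuclideanSpace.single i 1) * (x i * w x) =
        -∫ x, f x * fderiv ℝ (fun y : RSpace d => y i * w y) x (EuclideanSpace.single i 1) := by
    intro i
    rw [integral_mul_fderiv_eq_neg_fderiv_mul_of_integrable (hint1 i) (hint2 i)
      (Continuous.integrable_of_hasCompactSupport (by fun_prop) hc.mul_right)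
      (fun x _ => hf.differentiable one_ne_zero x)
      (fun x _ => (hg i).differentiable one_ne_zero x), neg_neg]
  calc ∫ x, fderiv ℝ f x x * w x
      = ∫ x, ∑ i, fderiv ℝ f x (EuclideanSpace.single i 1) * (x i * w x) := by
        congr 1 with x
        rw [← sum_coord_mul_fderiv f x x, Finset.sum_mul]
        exact Finset.sum_congr rfl fun i _ => by ring
    _ = -∫ x, ∑ i, f x *
          fderiv ℝ (fun y : RSpace d => y i * w y) x (EuclideanSpace.single i 1) := by
        rw [integral_finsetSum _ fun i _ => hint1 i, integral_finsetSum _ fun i _ => hint2 i,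
          ← Finset.sum_neg_distrib]
        exact Finset.sum_congr rfl fun i _ => hibp i
    _ = _ := by
        congr 2 with x
        rw [← Finset.mul_sum]
        simp_rw [hder]
        rw [Finset.sum_add_distrib, sum_coord_mul_fderiv w x x]
        simp

/-! ### The regularised weighted inequality -/

theorem contDiff_add_norm_sq_rpow {d : ℕ} {ε : ℝ} (hε : 0 < ε) (b : ℝ) :
    ContDiff ℝ 1 (fun x : RSpace d => (ε + ‖x‖ ^ 2) ^ b) :=
  (contDiff_const.add (contDiff_norm_sq ℝ)).rpow_const_of_ne fun x => by positivity

theorem fderiv_add_norm_sq_rpow_self {d : ℕ} {ε : ℝ} (hε : 0 < ε) (b : ℝ) (x : RSpace d) :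
    fderiv ℝ (fun y : RSpace d => (ε + ‖y‖ ^ 2) ^ b) x x =
      2 * b * (‖x‖ ^ 2 * (ε + ‖x‖ ^ 2) ^ (b - 1)) := by
  have h1 : HasFDerivAt (fun y : RSpace d => ε + ‖y‖ ^ 2) (2 • innerSL ℝ x) x :=
    ((hasStrictFDerivAt_norm_sq x).hasFDerivAt).const_add ε
  have h2 := h1.rpow_const (p := b) (Or.inl (by positivity))
  rw [h2.fderiv]
  simp
  ring

/-- Young's inequality with a non-optimal constant, by a dichotomy: if `p B ≤ δ A` the first term
suffices, otherwise `A ≤ (p / δ) B` and the second does. -/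
theorem mul_rpow_sub_one_mul_le {p δ A B : ℝ} (hp : 1 < p) (hδ : 0 < δ) (hA : 0 ≤ A)
    (hB : 0 ≤ B) : p * (A ^ (p - 1) * B) ≤ δ * A ^ p + p * (p / δ) ^ (p - 1) * B ^ p := by
  have hp0 : 0 < p := by linarith
  have hsplit : ∀ {t : ℝ}, 0 ≤ t → t ^ p = t ^ (p - 1) * t := fun {t} ht => by
    rw [← Real.rpow_add_one' ht (by linarith)]
    ring_nf
  have h1 : 0 ≤ A ^ (p - 1) := by positivity
  rcases le_total (p * B) (δ * A) with h | h
  · have : 0 ≤ p * (p / δ) ^ (p - 1) * B ^ p := by positivity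
    rw [hsplit hA]
    nlinarith [mul_le_mul_of_nonneg_left h h1]
  · have hAB : A ≤ p / δ * B := by
      rw [div_mul_eq_mul_div, le_div_iff₀ hδ]
      linarith
    have h2 : A ^ (p - 1) ≤ (p / δ) ^ (p - 1) * B ^ (p - 1) := by
      rw [← Real.mul_rpow (by positivity) hB]
      exact Real.rpow_le_rpow hA hAB (by linarith)
    have h3 : 0 ≤ δ * A ^ p := by positivity
    have h4 := mul_le_mul_of_nonneg_left (mul_le_mul_of_nonneg_right h2 hB) hp0.le
    rw [hsplit hB]
    nlinarith

theorem continuous_gradD {d : ℕ} {u : RSpace d → ℝ} (hu : ContDiff ℝ 1 u) :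
    Continuous (gradD u) := by
  have := hu.continuous_fderiv one_ne_zero
  unfold gradD partialD
  fun_prop

theorem hasCompactSupport_gradD {d : ℕ} {u : RSpace d → ℝ} (hu : HasCompactSupport u) :
    HasCompactSupport (gradD u) := by
  refine (hu.fderiv (𝕜 := ℝ)).mono fun x hx h => hx ?_
  ext i
  simp [gradD, partialD, h]

/-- The core estimate; what matters is that `C` depends neither on `u` nor on `ε`. -/
theorem integral_abs_rpow_mul_weight_le {d : ℕ} {p a : ℝ} (hp : 1 < p) (ha : 0 ≤ a)
    (had : a < d) : ∃ C : ℝ, 0 ≤ C ∧ ∀ u : RSpace d → ℝ, ContDiff ℝ 1 u → HasCompactSupport u →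
      ∀ ε : ℝ, 0 < ε → ∫ x, |u x| ^ p * (ε + ‖x‖ ^ 2) ^ (-a / 2) ≤
        C * ∫ x, ‖gradD u x‖ ^ p * (ε + ‖x‖ ^ 2) ^ ((p - a) / 2) := by
  have hp0 : 0 < p := by linarith
  -- Half of the coercivity constant `d - a`: Young's inequality spends one `δ` and the other
  -- survives on the left.
  set δ : ℝ := (d - a) / 2 with hδdef
  have hδ : 0 < δ := by rw [hδdef]; linarith
  set M : ℝ := p * (p / δ) ^ (p - 1) with hM
  refine ⟨M / δ, by positivity, fun u hu hc ε hε => ?_⟩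
  set w : ℝ → RSpace d → ℝ := fun b x => (ε + ‖x‖ ^ 2) ^ b with hwdef
  have hwc : ∀ b, Continuous (w b) := fun b => (contDiff_add_norm_sq_rpow hε b).continuous
  have hw0 : ∀ b x, 0 < w b x := fun b x => by simp only [hwdef]; positivity
  have hG := continuous_gradD hu
  have hcp : ∀ {F : Type} [NormedAddCommGroup F] {f : RSpace d → F}, HasCompactSupport f →
      HasCompactSupport fun x => ‖f x‖ ^ p := fun {F} _ {f} hf =>
    hf.comp_left (g := fun y => ‖y‖ ^ p) (by simp [hp0.ne'])
  have hup : ContDiff ℝ 1 (fun x => ‖u x‖ ^ p) := hu.norm_rpow hp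
  have hI : Integrable fun x => ‖u x‖ ^ p * w (-a / 2) x :=
    (hup.continuous.mul (hwc _)).integrable_of_hasCompactSupport (hcp hc).mul_right
  have hJ : Integrable fun x => ‖gradD u x‖ ^ p * w ((p - a) / 2) x :=
    ((hG.norm.rpow_const fun x => Or.inr hp0.le).mul (hwc _)).integrable_of_hasCompactSupport
      (hcp (hasCompactSupport_gradD hc)).mul_right
  have hwd := (contDiff_add_norm_sq_rpow (d := d) hε (-a / 2))
  have hdiv := integral_fderiv_self_mul hup (hcp hc) hwd
  have hcfu : Continuous (fderiv ℝ fun x => ‖u x‖ ^ p) := hup.continuous_fderiv one_ne_zero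
  have hK : Integrable fun x => -(fderiv ℝ (fun x => ‖u x‖ ^ p) x x * w (-a / 2) x) :=
    (((hcfu.clm_apply continuous_id).mul (hwc _)).integrable_of_hasCompactSupport
      (HasCompactSupport.mul_right <| (hcp hc).fderiv (𝕜 := ℝ) |>.mono fun x hx h => hx
        (by simp only [h, zero_apply]))).neg
  have hcwd := hwd.continuous_fderiv one_ne_zero
  have hL : Integrable fun x => ‖u x‖ ^ p * (d * w (-a / 2) x + fderiv ℝ (w (-a / 2)) x x) :=
    (hup.continuous.mul ((continuous_const.mul (hwc _)).add
      (hcwd.clm_apply continuous_id))).integrable_of_hasCompactSupport (hcp hc).mul_right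
  have lower : (d - a) * ∫ x, ‖u x‖ ^ p * w (-a / 2) x ≤
      ∫ x, ‖u x‖ ^ p * (d * w (-a / 2) x + fderiv ℝ (w (-a / 2)) x x) := by
    rw [← integral_const_mul]
    refine integral_mono (hI.const_mul _) hL fun x => ?_
    have h1 : fderiv ℝ (w (-a / 2)) x x = 2 * (-a / 2) * (‖x‖ ^ 2 * w (-a / 2 - 1) x) :=
      fderiv_add_norm_sq_rpow_self hε _ x
    have h2 : w (-a / 2) x = w (-a / 2 - 1) x * (ε + ‖x‖ ^ 2) := by
      simp only [hwdef]
      rw [← Real.rpow_add_one (by positivity)]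
      ring_nf
    -- Hence the radial derivative of the weight costs at most `a w`.
    have h3 : ‖x‖ ^ 2 * w (-a / 2 - 1) x ≤ w (-a / 2) x := by
      rw [h2]
      nlinarith [hw0 (-a / 2 - 1) x]
    have h4 : 0 ≤ ‖u x‖ ^ p := by positivity
    have h5 : (d - a) * w (-a / 2) x ≤ d * w (-a / 2) x + fderiv ℝ (w (-a / 2)) x x := by
      rw [h1]
      nlinarith [mul_le_mul_of_nonneg_left h3 ha]
    calc (d - a) * (‖u x‖ ^ p * w (-a / 2) x) = ‖u x‖ ^ p * ((d - a) * w (-a / 2) x) := by ring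
      _ ≤ _ := mul_le_mul_of_nonneg_left h5 h4
  have upper : ∫ x, -(fderiv ℝ (fun x => ‖u x‖ ^ p) x x * w (-a / 2) x) ≤
      ∫ x, (δ * (‖u x‖ ^ p * w (-a / 2) x) + M * (‖gradD u x‖ ^ p * w ((p - a) / 2) x)) := by
    refine integral_mono hK ((hI.const_mul _).add (hJ.const_mul _)) fun x => ?_
    -- Bounding `|x|` by `s` makes `s ^ p` combine with the weight into a single power of `ε +
    -- |x|²`.
    set s : ℝ := (ε + ‖x‖ ^ 2) ^ (1 / 2 : ℝ) with hs
    have hs0 : 0 ≤ s := by positivity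
    have hxs : ‖x‖ ≤ s := by
      rw [hs, ← Real.sqrt_eq_rpow]
      exact Real.le_sqrt_of_sq_le (by linarith)
    have hsp : s ^ p * w (-a / 2) x = w ((p - a) / 2) x := by
      rw [hs, ← Real.rpow_mul (by positivity)]
      simp only [hwdef]
      rw [← Real.rpow_add (by positivity)]
      ring_nf
    have hder : |fderiv ℝ (fun x => ‖u x‖ ^ p) x x| ≤
        p * (‖u x‖ ^ (p - 1) * (‖gradD u x‖ * s)) := by
      rw [(hu.differentiable one_ne_zero).fderiv_norm_rpow hp]
      simp only [smul_apply, ContinuousLinearMap.comp_apply,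
        innerSL_apply_apply, smul_eq_mul]
      have h1 : |fderiv ℝ u x x| ≤ ‖gradD u x‖ * s := by
        rw [fderiv_eq_inner_gradD]
        calc _ ≤ ‖x‖ * ‖gradD u x‖ := abs_real_inner_le_norm _ _
          _ ≤ s * ‖gradD u x‖ := by gcongr
          _ = _ := mul_comm _ _
      have h2 : |inner ℝ (u x) (fderiv ℝ u x x)| = ‖u x‖ * |fderiv ℝ u x x| := by
        simp [abs_mul, mul_comm]
      rw [abs_mul, h2, abs_of_nonneg (by positivity)]
      calc p * ‖u x‖ ^ (p - 2) * (‖u x‖ * |fderiv ℝ u x x|)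
          = p * ((‖u x‖ ^ (p - 2) * ‖u x‖) * |fderiv ℝ u x x|) := by ring
        _ = p * (‖u x‖ ^ (p - 1) * |fderiv ℝ u x x|) := by
            -- Zeros of `u` are covered: the total exponent `p - 1` is nonzero, even if `p - 2` is
            -- negative.
            rw [← Real.rpow_add_one' (by positivity) (by linarith)]
            ring_nf
        _ ≤ _ := by gcongr
    have hy := mul_rpow_sub_one_mul_le hp hδ (norm_nonneg (u x))
      (mul_nonneg (norm_nonneg (gradD u x)) hs0)
    have h0 := (hw0 (-a / 2) x).le
    calc -(fderiv ℝ (fun x => ‖u x‖ ^ p) x x * w (-a / 2) x)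
        = (-fderiv ℝ (fun x => ‖u x‖ ^ p) x x) * w (-a / 2) x := by ring
      _ ≤ (δ * ‖u x‖ ^ p + M * (‖gradD u x‖ * s) ^ p) * w (-a / 2) x := by
          gcongr
          exact (neg_le_abs _).trans (hder.trans hy)
      _ = _ := by
          rw [Real.mul_rpow (norm_nonneg _) hs0, ← hsp]
          ring
  rw [integral_add (hI.const_mul _) (hJ.const_mul _), integral_const_mul, integral_const_mul,
    integral_neg] at upper
  have hdiv' : ∫ x, fderiv ℝ (fun x => ‖u x‖ ^ p) x x * w (-a / 2) x =
    -∫ x, ‖u x‖ ^ p * (d * w (-a / 2) x + fderiv ℝ (w (-a / 2)) x x) := hdiv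
  rw [hdiv', neg_neg] at upper
  change ∫ x, ‖u x‖ ^ p * w (-a / 2) x ≤ M / δ * ∫ x, ‖gradD u x‖ ^ p * w ((p - a) / 2) x
  rw [div_mul_eq_mul_div, le_div_iff₀ hδ]
  have : (d - a : ℝ) = 2 * δ := by rw [hδdef]; ring
  rw [this] at lower
  linarith

/-! ### Removing the regularisation; the first-order inequality -/

/-- Fatou's lemma along `ε = 1 / (n + 1)`; the integrands converge off the origin, a null set. -/
theorem lintegral_enorm_rpow_div_le {d : ℕ} [NeZero d] {u : RSpace d → ℝ} {p a K : ℝ}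
    (hp : 0 < p) (ha : 0 < a) (hu : Continuous u) (hc : HasCompactSupport u)
    (h : ∀ ε : ℝ, 0 < ε → ∫ x, |u x| ^ p * (ε + ‖x‖ ^ 2) ^ (-a / 2) ≤ K) :
    ∫⁻ x, ‖u x‖ₑ ^ p / ‖x‖ₑ ^ a ≤ ENNReal.ofReal K := by
  set F : ℕ → RSpace d → ℝ := fun n x => |u x| ^ p * (1 / ((n : ℝ) + 1) + ‖x‖ ^ 2) ^ (-a / 2)
    with hF
  have hε : ∀ n : ℕ, (0 : ℝ) < 1 / ((n : ℝ) + 1) := fun n => by positivity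
  have hFc : ∀ n, Continuous (F n) := fun n =>
    (hu.abs.rpow_const fun x => Or.inr hp.le).mul
      (contDiff_add_norm_sq_rpow (hε n) (-a / 2)).continuous
  have hFs : ∀ n, HasCompactSupport (F n) := fun n =>
    HasCompactSupport.mul_right (hc.comp_left (g := fun y => |y| ^ p) (by simp [hp.ne']))
  have hF0 : ∀ n x, 0 ≤ F n x := fun n x => by
    have := hε n
    simp only [hF]
    positivity
  have hlim : ∀ᵐ x : RSpace d, ‖u x‖ₑ ^ p / ‖x‖ₑ ^ a =
      liminf (fun n => ENNReal.ofReal (F n x)) atTop := by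
    filter_upwards [Measure.ae_ne volume (0 : RSpace d)] with x hx
    have hx0 : 0 < ‖x‖ := norm_pos_iff.2 hx
    have h1 : Tendsto (fun n : ℕ => F n x) atTop
        (𝓝 (|u x| ^ p * (0 + ‖x‖ ^ 2) ^ (-a / 2))) := by
      refine Tendsto.const_mul _ (Tendsto.rpow_const ?_ (Or.inl (by positivity)))
      exact tendsto_one_div_add_atTop_nhds_zero_nat.add_const _
    rw [(ENNReal.tendsto_ofReal h1).liminf_eq, zero_add, neg_div,
      Real.rpow_neg (by positivity), ← Real.rpow_natCast, ← Real.rpow_mul hx0.le, ← div_eq_mul_inv,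
      ENNReal.ofReal_div_of_pos (by positivity), ← ENNReal.ofReal_rpow_of_nonneg (abs_nonneg _) hp.le,
      ← ENNReal.ofReal_rpow_of_nonneg hx0.le (by positivity), ofReal_norm, ← Real.norm_eq_abs,
      ofReal_norm]
    congr 2
    push_cast
    ring
  calc ∫⁻ x, ‖u x‖ₑ ^ p / ‖x‖ₑ ^ a
      = ∫⁻ x, liminf (fun n => ENNReal.ofReal (F n x)) atTop := lintegral_congr_ae hlim
    _ ≤ liminf (fun n => ∫⁻ x, ENNReal.ofReal (F n x)) atTop :=
        lintegral_liminf_le fun n => (hFc n).measurable.ennreal_ofReal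
    _ ≤ ENNReal.ofReal K := by
        refine liminf_le_of_le (by isBoundedDefault) fun b hb => ?_
        obtain ⟨n, hn⟩ := hb.exists
        refine hn.trans ?_
        rw [← ofReal_integral_eq_lintegral_ofReal
          ((hFc n).integrable_of_hasCompactSupport (hFs n)) (ae_of_all _ (hF0 n))]
        exact ENNReal.ofReal_le_ofReal (h _ (hε n))

theorem integrable_norm_rpow_of_hasCompactSupport {d : ℕ} {F : Type*} [NormedAddCommGroup F]
    {G : RSpace d → F} {p : ℝ} (hp : 0 < p) (hG : Continuous G) (hc : HasCompactSupport G) :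
    Integrable fun x => ‖G x‖ ^ p :=
  (hG.norm.rpow_const fun x => Or.inr hp.le).integrable_of_hasCompactSupport
    (hc.comp_left (g := fun y => ‖y‖ ^ p) (by simp [hp.ne']))

theorem eLpNorm_rpow_eq_ofReal_integral {d : ℕ} {F : Type*} [NormedAddCommGroup F]
    {G : RSpace d → F} {p : ℝ} (hp : 0 < p) (hG : Continuous G) (hc : HasCompactSupport G) :
    eLpNorm G (ENNReal.ofReal p) volume ^ p = ENNReal.ofReal (∫ x, ‖G x‖ ^ p) := by
  rw [eLpNorm_eq_lintegral_rpow_enorm_toReal (by simpa using hp) ENNReal.ofReal_ne_top,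
    ENNReal.toReal_ofReal hp.le, ← ENNReal.rpow_mul, one_div_mul_cancel hp.ne', ENNReal.rpow_one,
    ofReal_integral_eq_lintegral_ofReal (integrable_norm_rpow_of_hasCompactSupport hp hG hc)
      (ae_of_all _ fun x => by positivity)]
  refine lintegral_congr fun x => ?_
  rw [← ENNReal.ofReal_rpow_of_nonneg (norm_nonneg _) hp.le, ofReal_norm]

theorem hardy_inequality {d : ℕ} {p : ℝ} (hp : 1 < p) (hpd : p < d) :
    ∃ N : ℝ≥0, ∀ u : RSpace d → ℝ, ContDiff ℝ 1 u → HasCompactSupport u →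
      ∫⁻ x, ‖u x‖ₑ ^ p / ‖x‖ₑ ^ p ≤
        (N : ℝ≥0∞) * eLpNorm (gradD u) (ENNReal.ofReal p) volume ^ p := by
  have hp0 : 0 < p := by linarith
  have : NeZero d := ⟨by rintro rfl; norm_num at hpd; linarith⟩
  obtain ⟨C, hC, h⟩ := integral_abs_rpow_mul_weight_le hp hp0.le hpd
  refine ⟨C.toNNReal, fun u hu hc => ?_⟩
  rw [eLpNorm_rpow_eq_ofReal_integral hp0 (continuous_gradD hu) (hasCompactSupport_gradD hc),
    ENNReal.ofNNReal_toNNReal, ← ENNReal.ofReal_mul hC]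
  refine lintegral_enorm_rpow_div_le hp0 hp0 hu.continuous hc fun ε hε => ?_
  simpa using h u hu hc ε hε

/-! ### The second-order inequality -/

/-- Reduces the gradient to scalar components, to which the weighted estimate can be applied again.
-/
theorem norm_gradD_rpow_le {d : ℕ} (u : RSpace d → ℝ) (x : RSpace d) {r : ℝ} (hr : 1 ≤ r) :
    ‖gradD u x‖ ^ r ≤ (d : ℝ) ^ (r - 1) * ∑ i, |partialD i u x| ^ r := by
  have h1 : ‖gradD u x‖ ≤ ∑ i, |partialD i u x| := by
    rw [EuclideanSpace.norm_eq, Real.sqrt_le_left (by positivity)]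
    simpa [gradD] using Finset.sum_sq_le_sq_sum_of_nonneg (s := Finset.univ)
      (f := fun i => |partialD i u x|) fun i _ => abs_nonneg _
  refine (Real.rpow_le_rpow (norm_nonneg _) h1 (by linarith)).trans ?_
  simpa using Real.rpow_sum_le_const_mul_sum_rpow Finset.univ (fun i => partialD i u x) hr

theorem norm_gradD_partialD_le {d : ℕ} (u : RSpace d → ℝ) (j : Fin d) (x : RSpace d) :
    ‖gradD (partialD j u) x‖ ≤ ‖hessD u x‖ := by
  rw [EuclideanSpace.norm_eq, EuclideanSpace.norm_eq]
  refine Real.sqrt_le_sqrt ?_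
  rw [Fintype.sum_prod_type]
  refine Finset.sum_le_sum fun i _ => ?_
  exact Finset.single_le_sum (f := fun j => ‖hessD u x (i, j)‖ ^ 2) (fun _ _ => by positivity)
    (Finset.mem_univ j)

theorem contDiff_partialD {d : ℕ} {n m : ℕ∞ω} {u : RSpace d → ℝ} (hu : ContDiff ℝ n u)
    (hmn : m + 1 ≤ n) (i : Fin d) : ContDiff ℝ m (partialD i u) :=
  (hu.fderiv_right hmn).clm_apply contDiff_const

theorem hasCompactSupport_partialD {d : ℕ} {u : RSpace d → ℝ} (hu : HasCompactSupport u)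
    (i : Fin d) : HasCompactSupport (partialD i u) :=
  hu.fderiv_apply ℝ _

theorem continuous_hessD {d : ℕ} {u : RSpace d → ℝ} (hu : ContDiff ℝ 2 u) :
    Continuous (hessD u) := by
  have : ∀ i j, Continuous (partialD i (partialD j u)) := fun i j =>
    (contDiff_partialD (m := 0) (contDiff_partialD (m := 1) hu (by norm_num) j)
      (by norm_num) i).continuous
  unfold hessD
  fun_prop

theorem hasCompactSupport_hessD {d : ℕ} {u : RSpace d → ℝ} (hu : HasCompactSupport u) :
    HasCompactSupport (hessD u) := by
  refine hu.mono' fun x hx => ?_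
  by_contra h
  refine hx ?_
  ext ij
  by_contra h'
  refine h ?_
  have h1 : x ∈ tsupport (partialD ij.2 u) :=
    tsupport_fderiv_apply_subset ℝ _ (subset_tsupport _ h')
  exact tsupport_fderiv_apply_subset ℝ _ h1

theorem second_order_hardy_inequality {d : ℕ} {r : ℝ} (hr : 1 < r) (hrd : r < (d : ℝ) / 2) :
    ∃ N : ℝ≥0, ∀ u : RSpace d → ℝ, ContDiff ℝ 2 u → HasCompactSupport u →
      ∫⁻ x, ‖u x‖ₑ ^ r / ‖x‖ₑ ^ (2 * r) ≤
        (N : ℝ≥0∞) * eLpNorm (hessD u) (ENNReal.ofReal r) volume ^ r := by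
  have hr0 : 0 < r := by linarith
  have : NeZero d := ⟨by rintro rfl; norm_num at hrd; linarith⟩
  -- The hypothesis `r < d / 2` is exactly the requirement `a < d` here; the second use, with `a =
  -- r`, ends with no weight.
  obtain ⟨C, hC, h⟩ := integral_abs_rpow_mul_weight_le (d := d) (a := 2 * r) hr (by linarith)
    (by linarith)
  obtain ⟨C', hC', h'⟩ := integral_abs_rpow_mul_weight_le (d := d) (a := r) hr (by linarith)
    (by linarith)
  set M : ℝ := C * ((d : ℝ) ^ (r - 1) * (d * C')) with hMdef
  have hM : 0 ≤ M := by positivity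
  refine ⟨M.toNNReal, fun u hu hc => ?_⟩
  rw [eLpNorm_rpow_eq_ofReal_integral hr0 (continuous_hessD hu) (hasCompactSupport_hessD hc),
    ENNReal.ofNNReal_toNNReal, ← ENNReal.ofReal_mul hM]
  refine lintegral_enorm_rpow_div_le hr0 (by positivity) hu.continuous hc fun ε hε => ?_
  have hu1 : ContDiff ℝ 1 u := hu.of_le (by norm_num)
  have hd1 : ∀ i, ContDiff ℝ 1 (partialD i u) := fun i => contDiff_partialD hu (by norm_num) i
  have hdc : ∀ i, HasCompactSupport (partialD i u) := hasCompactSupport_partialD hc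
  have hw := (contDiff_add_norm_sq_rpow (d := d) hε (-r / 2)).continuous
  have hpart : ∀ i, ∫ x, |partialD i u x| ^ r * (ε + ‖x‖ ^ 2) ^ (-r / 2) ≤
      C' * ∫ x, ‖hessD u x‖ ^ r := fun i => by
    refine (h' _ (hd1 i) (hdc i) ε hε).trans (mul_le_mul_of_nonneg_left ?_ hC')
    simp only [sub_self, zero_div, Real.rpow_zero, mul_one]
    refine integral_mono
      (integrable_norm_rpow_of_hasCompactSupport hr0 (continuous_gradD (hd1 i))
        (hasCompactSupport_gradD (hdc i)))
      (integrable_norm_rpow_of_hasCompactSupport hr0 (continuous_hessD hu)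
        (hasCompactSupport_hessD hc)) fun x => ?_
    exact Real.rpow_le_rpow (norm_nonneg _) (norm_gradD_partialD_le u i x) hr0.le
  have hint : ∀ i, Integrable fun x => |partialD i u x| ^ r * (ε + ‖x‖ ^ 2) ^ (-r / 2) :=
    fun i => (((hd1 i).continuous.abs.rpow_const fun x => Or.inr hr0.le).mul
      hw).integrable_of_hasCompactSupport
      (HasCompactSupport.mul_right ((hdc i).comp_left (g := fun y => |y| ^ r) (by simp [hr0.ne'])))
  have hgrad : ∫ x, ‖gradD u x‖ ^ r * (ε + ‖x‖ ^ 2) ^ ((r - 2 * r) / 2) ≤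
      (d : ℝ) ^ (r - 1) * (d * C') * ∫ x, ‖hessD u x‖ ^ r := by
    have hexp : (r - 2 * r) / 2 = -r / 2 := by ring
    rw [hexp]
    calc ∫ x, ‖gradD u x‖ ^ r * (ε + ‖x‖ ^ 2) ^ (-r / 2)
        ≤ ∫ x, (d : ℝ) ^ (r - 1) *
            ∑ i, |partialD i u x| ^ r * (ε + ‖x‖ ^ 2) ^ (-r / 2) := by
          refine integral_mono ?_ ((integrable_finsetSum _ fun i _ => hint i).const_mul _)
            fun x => ?_
          · exact (((continuous_gradD hu1).norm.rpow_const fun x => Or.inr hr0.le).mul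
              hw).integrable_of_hasCompactSupport (HasCompactSupport.mul_right
              ((hasCompactSupport_gradD hc).comp_left (g := fun y => ‖y‖ ^ r)
                (by simp [hr0.ne'])))
          · simp only
            rw [← Finset.sum_mul, ← mul_assoc]
            exact mul_le_mul_of_nonneg_right (norm_gradD_rpow_le u x hr.le) (by positivity)
      _ = (d : ℝ) ^ (r - 1) * ∑ i, ∫ x, |partialD i u x| ^ r * (ε + ‖x‖ ^ 2) ^ (-r / 2) := by
          rw [integral_const_mul, integral_finsetSum _ fun i _ => hint i]
      _ ≤ (d : ℝ) ^ (r - 1) * ∑ _i : Fin d, C' * ∫ x, ‖hessD u x‖ ^ r := by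
          gcongr with i
          exact hpart i
      _ = _ := by
          simp
          ring
  calc _ ≤ C * ∫ x, ‖gradD u x‖ ^ r * (ε + ‖x‖ ^ 2) ^ ((r - 2 * r) / 2) := h u hu1 hc ε hε
    _ ≤ C * ((d : ℝ) ^ (r - 1) * (d * C') * ∫ x, ‖hessD u x‖ ^ r) := by gcongr
    _ = _ := by rw [hMdef]; ring

/-! ### Morrey norms of negative powers of the norm -/

theorem lintegral_ball_one_inv_rpow_lt_top {d : ℕ} [NeZero d] {q : ℝ} (hq : 0 < q) (hqd : q < d) :
    ∫⁻ y in ball (0 : RSpace d) 1, (‖y‖ₑ ^ q)⁻¹ < ⊤ := by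
  have hmeas : Measurable fun y : RSpace d => ‖y‖ ^ (-q) := by fun_prop
  have hint : IntegrableOn (fun y : RSpace d => ‖y‖ ^ (-q)) (ball 0 1) volume := by
    refine integrableOn_ball_of_norm_le_rpow (C := 1) (α := q) ?_ (by simpa using hqd) ?_
      hmeas.aestronglyMeasurable
    · simpa using NeZero.one_le
    · refine ae_of_all _ fun y => ?_
      rw [one_mul, Real.norm_of_nonneg (by positivity)]
  refine lt_of_eq_of_lt (lintegral_congr_ae ?_) hint.2
  filter_upwards [ae_restrict_of_ae (Measure.ae_ne volume (0 : RSpace d))] with y hy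
  have hy0 : 0 < ‖y‖ := norm_pos_iff.2 hy
  rw [Real.rpow_neg hy0.le, enorm_inv (by positivity), Real.enorm_of_nonneg (by positivity),
    ← ENNReal.ofReal_rpow_of_nonneg hy0.le hq.le, ofReal_norm]

/-- Change of variables `y = ρ x`. -/
theorem lintegral_ball_inv_rpow_eq {d : ℕ} {q ρ : ℝ} (hρ : 0 < ρ) :
    ∫⁻ y in ball (0 : RSpace d) ρ, (‖y‖ₑ ^ q)⁻¹ =
      ENNReal.ofReal (ρ ^ d) * ((ENNReal.ofReal ρ ^ q)⁻¹ *
        ∫⁻ y in ball (0 : RSpace d) 1, (‖y‖ₑ ^ q)⁻¹) := by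
  have hR0 : ENNReal.ofReal ρ ≠ 0 := by simpa using hρ
  have hm : Measurable fun y : RSpace d => (‖y‖ₑ ^ q)⁻¹ := by fun_prop
  have h1 := setLIntegral_map (μ := (volume : Measure (RSpace d)))
    (measurableSet_ball (x := (0 : RSpace d)) (ε := ρ)) hm (measurable_const_smul ρ)
  rw [Measure.map_addHaar_smul _ hρ.ne', Measure.restrict_smul, lintegral_smul_measure] at h1
  have hpre : (fun x : RSpace d => ρ • x) ⁻¹' ball 0 ρ = ball 0 1 := by
    ext x
    simp [norm_smul, abs_of_pos hρ, hρ]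
  have hfun : ∀ x : RSpace d, (‖ρ • x‖ₑ ^ q)⁻¹ = (ENNReal.ofReal ρ ^ q)⁻¹ * (‖x‖ₑ ^ q)⁻¹ := by
    intro x
    rw [enorm_smul, Real.enorm_of_nonneg hρ.le,
      ENNReal.mul_rpow_of_ne_top ENNReal.ofReal_ne_top enorm_ne_top, ENNReal.mul_inv]
    · exact Or.inl (by simp [ENNReal.rpow_eq_zero_iff, hR0])
    · exact Or.inl (by simp [ENNReal.rpow_eq_top_iff, hR0])
  rw [hpre] at h1
  simp_rw [hfun] at h1
  rw [lintegral_const_mul _ hm] at h1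
  rw [← h1, smul_eq_mul, ← mul_assoc, ← ENNReal.ofReal_mul (by positivity)]
  simp [abs_of_pos hρ, hρ.ne']

/-- Uniform in the centre: points of the ball with `|y| < ρ` contribute at most the integral over
the ball of radius `ρ` at the origin, and elsewhere the integrand is at most `ρ^(-q)`, which gives
the `+ 1`. -/
theorem setLAverage_inv_rpow_le {d : ℕ} [NeZero d] {q ρ : ℝ} (hq : 0 < q) (hρ : 0 < ρ)
    (x : RSpace d) : ⨍⁻ y in ball x ρ, (‖y‖ₑ ^ q)⁻¹ ∂volume ≤
      (ENNReal.ofReal ρ ^ q)⁻¹ *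
        ((∫⁻ y in ball (0 : RSpace d) 1, (‖y‖ₑ ^ q)⁻¹) / volume (ball (0 : RSpace d) 1) + 1) := by
  set K := ∫⁻ y in ball (0 : RSpace d) 1, (‖y‖ₑ ^ q)⁻¹
  set V := volume (ball (0 : RSpace d) 1) with hV
  set R := (ENNReal.ofReal ρ ^ q)⁻¹ with hR
  have hD0 : ENNReal.ofReal (ρ ^ d) ≠ 0 := by simp [hρ]
  have hvol : volume (ball x ρ) = ENNReal.ofReal (ρ ^ d) * V := by
    rw [Measure.addHaar_ball_of_pos _ _ hρ]
    simp [hV]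
  have hv0 : volume (ball x ρ) ≠ 0 := (measure_ball_pos _ _ hρ).ne'
  have hvt : volume (ball x ρ) ≠ ⊤ := measure_ball_lt_top.ne
  have hle : ∫⁻ y in ball x ρ, (‖y‖ₑ ^ q)⁻¹ ≤
      ENNReal.ofReal (ρ ^ d) * (R * K) + R * volume (ball x ρ) := by
    calc ∫⁻ y in ball x ρ, (‖y‖ₑ ^ q)⁻¹
        ≤ ∫⁻ y in ball x ρ, ((ball (0 : RSpace d) ρ).indicator (fun y => (‖y‖ₑ ^ q)⁻¹) y + R) := by
          refine lintegral_mono fun y => ?_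
          by_cases hy : y ∈ ball (0 : RSpace d) ρ
          · simp only [Set.indicator_of_mem hy]
            exact le_self_add
          · simp only [Set.indicator_of_notMem hy, zero_add, hR]
            rw [mem_ball_zero_iff, not_lt] at hy
            rw [ENNReal.inv_le_inv]
            refine ENNReal.rpow_le_rpow ?_ hq.le
            rw [← ofReal_norm]
            exact ENNReal.ofReal_le_ofReal hy
      _ = (∫⁻ y in ball x ρ, (ball (0 : RSpace d) ρ).indicator (fun y => (‖y‖ₑ ^ q)⁻¹) y) +
            R * volume (ball x ρ) := by
          rw [lintegral_add_right _ measurable_const, setLIntegral_const]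
      _ ≤ _ := by
          gcongr
          rw [← lintegral_ball_inv_rpow_eq hρ]
          exact (setLIntegral_le_lintegral _ _).trans (lintegral_indicator_le _ _)
  rw [setLAverage_eq]
  calc _ ≤ (ENNReal.ofReal (ρ ^ d) * (R * K) + R * volume (ball x ρ)) / volume (ball x ρ) := by
        gcongr
    _ = ENNReal.ofReal (ρ ^ d) * (R * K) / (ENNReal.ofReal (ρ ^ d) * V) + R := by
        rw [ENNReal.add_div, ENNReal.mul_div_cancel_right hv0 hvt, hvol]
    _ = R * (K / V) + R := by
        rw [ENNReal.mul_div_mul_left _ _ hD0 ENNReal.ofReal_ne_top, mul_div_assoc]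
    _ = _ := by ring

/-- Since `(|x|^(-k))^(q/k) = |x|^(-q)` off the origin, one average bound serves both `k = 1` and `k
= 2`; the factor `ρ^k` cancels the scaling. -/
theorem memMorrey_inv_norm_pow {d : ℕ} {q : ℝ} (hq : 0 < q) (hqd : q < d) {k : ℕ} (hk : k ≠ 0) :
    MemMorrey (q / k) k fun x : RSpace d => (‖x‖ ^ k)⁻¹ := by
  have : NeZero d := ⟨by rintro rfl; norm_num at hqd; linarith⟩
  have hk0 : (0 : ℝ) < k := by exact_mod_cast Nat.pos_of_ne_zero hk
  refine ⟨by fun_prop, ?_⟩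
  set A := (∫⁻ y in ball (0 : RSpace d) 1, (‖y‖ₑ ^ q)⁻¹) / volume (ball (0 : RSpace d) 1) + 1
  have hA : A < ⊤ := by
    refine ENNReal.add_lt_top.2 ⟨ENNReal.div_lt_top ?_ ?_, ENNReal.one_lt_top⟩
    · exact (lintegral_ball_one_inv_rpow_lt_top hq hqd).ne
    · exact (measure_ball_pos _ _ one_pos).ne'
  refine lt_of_le_of_lt ?_ (ENNReal.rpow_lt_top_of_nonneg (y := 1 / (q / k)) (by positivity) hA.ne)
  refine iSup₂_le fun ρ hρ => ?_
  have hR0 : ENNReal.ofReal ρ ≠ 0 := by simpa using hρ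
  -- Only an inequality: at `y = 0` the real inverse is `0`, while the extended one is `⊤`.
  have hpt : ∀ y : RSpace d, ‖(‖y‖ ^ k)⁻¹‖ₑ ^ (q / k) ≤ (‖y‖ₑ ^ q)⁻¹ := by
    intro y
    by_cases hy : y = 0
    · simp [hy, hq]
    have hy0 : 0 < ‖y‖ := norm_pos_iff.2 hy
    refine le_of_eq ?_
    rw [enorm_inv (by positivity), enorm_pow, enorm_norm, ENNReal.inv_rpow, ← ENNReal.rpow_natCast,
      ← ENNReal.rpow_mul, mul_div_cancel₀ _ hk0.ne']
  have hball : ∀ x : RSpace d,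
      (⨍⁻ y in ball x ρ, ‖(‖y‖ ^ k)⁻¹‖ₑ ^ (q / k) ∂volume) ^ (1 / (q / k)) ≤
        (ENNReal.ofReal ρ ^ (k : ℝ))⁻¹ * A ^ (1 / (q / k)) := by
    intro x
    calc _ ≤ ((ENNReal.ofReal ρ ^ q)⁻¹ * A) ^ (1 / (q / k)) := by
          refine ENNReal.rpow_le_rpow ?_ (by positivity)
          exact (laverage_mono_ae (ae_of_all _ hpt)).trans (setLAverage_inv_rpow_le hq hρ x)
      _ = _ := by
          rw [ENNReal.mul_rpow_of_nonneg _ _ (by positivity), ENNReal.inv_rpow, ← ENNReal.rpow_mul]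
          congr 3
          field_simp
  calc _ ≤ ENNReal.ofReal (ρ ^ (k : ℝ)) *
        ((ENNReal.ofReal ρ ^ (k : ℝ))⁻¹ * A ^ (1 / (q / k))) := by
        gcongr
        exact iSup_le hball
    _ = _ := by
        rw [← mul_assoc, ENNReal.ofReal_rpow_of_pos hρ, ENNReal.mul_inv_cancel, one_mul]
        · simpa using Real.rpow_pos_of_pos hρ k
        · exact ENNReal.ofReal_ne_top

theorem corollary2p4 (d : ℕ) (hd : 2 ≤ d) :
    (∀ p : ℝ, 1 < p → p < (d : ℝ) →
      ∃ N : ℝ≥0, ∀ u : RSpace d → ℝ, ContDiff ℝ ∞ u → HasCompactSupport u →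
        ∫⁻ x, ‖u x‖ₑ ^ p / ‖x‖ₑ ^ p ∂volume
          ≤ (N : ℝ≥0∞) * eLpNorm (gradD u) (ENNReal.ofReal p) volume ^ p) ∧
    (∀ r : ℝ, 1 < r → r < (d : ℝ) / 2 →
      ∃ N : ℝ≥0, ∀ u : RSpace d → ℝ, ContDiff ℝ ∞ u → HasCompactSupport u →
        ∫⁻ x, ‖u x‖ₑ ^ r / ‖x‖ₑ ^ (2 * r) ∂volume
          ≤ (N : ℝ≥0∞) * eLpNorm (hessD u) (ENNReal.ofReal r) volume ^ r) ∧
    (∀ q : ℝ, 1 < q → q < (d : ℝ) →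
      MemMorrey q 1 (fun x : RSpace d => ‖x‖⁻¹) ∧
      MemMorrey (q / 2) 2 (fun x : RSpace d => (‖x‖ ^ 2)⁻¹)) := by
  refine ⟨fun p hp hpd => ?_, fun r hr hrd => ?_, fun q hq hqd => ⟨?_, ?_⟩⟩
  · obtain ⟨N, hN⟩ := hardy_inequality hp hpd
    exact ⟨N, fun u hu hc => hN u (hu.of_le (by exact_mod_cast le_top)) hc⟩
  · obtain ⟨N, hN⟩ := second_order_hardy_inequality hr hrd
    exact ⟨N, fun u hu hc => hN u (hu.of_le (WithTop.coe_le_coe.2 (le_top : (2 : ℕ∞) ≤ ⊤))) hc⟩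
  · simpa using memMorrey_inv_norm_pow (by linarith) hqd one_ne_zero
  · simpa using memMorrey_inv_norm_pow (by linarith) hqd two_ne_zero
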